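/- All graphs are finite and simple. For a graph $G$ with adjacency matrix $A(G)$ and diagonal matrix of vertex degrees $D(G)$, and for $\alpha\in[0,1]$, let $A_\alpha(G)=\alpha D(G)+(1-\alpha)A(G)$, and let the $A_\alpha$-index $\lambda_\alpha(G)$ be the largest eigenvalue of $A_\alpha(G)$. The independence number of $G$ is the largest number of pairwise non-adjacent vertices of $G$. Let $n$ and $i$ be integers with $\lceil n/2\rceil\le i\le n-1$. Write $K_{i,n-i}$ for the complete bipartite graph with parts of sizes $i$ and $n-i$, and $S^*_{n,i}$ for the graph obtained from the star $K_{1,i}$ by attaching one pendant edge to each of $n-i-1$ of its $i$ non-central vertices (a graph with $n$ vertices in total). (a) The graph $K_{i,n-i}$ is a connected $n$-vertex bipartite graph with independence number $i$. For every $\alpha\in[\tfrac12,1)$ and every $n$-vertex bipartite graph $G$ with independence number $i$, $$\lambda_\alpha(G)\le\lambda_\alpha(K_{i,n-i}),$$ with equality if and only if $G\cong K_{i,n-i}$. (b) Suppose $n\ge 4$. The graph $S^*_{n,i}$ is an $n$-vertex tree with independence number $i$. For every $\alpha\in[0,1)$ and every $n$-vertex tree $T$ with independence number $i$, $$\lambda_\alpha(T)\le\lambda_\alpha(S^*_{n,i}),$$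 with equality if and only if $T\cong S^*_{n,i}$. -/

import Mathlib

open Classical in
/-- The matrix `A_α(G) = α D(G) + (1 - α) A(G)`. -/
noncomputable def aAlphaMatrix {V : Type*} [Fintype V] (G : SimpleGraph V) (α : ℝ) :
    Matrix V V ℝ :=
  α • G.degMatrix ℝ + (1 - α) • G.adjMatrix ℝ

open Classical in
/-- The `A_α`-index `λ_α(G)`: the largest eigenvalue of `A_α(G)`. The supremum is attained on every
nonempty finite vertex type, see `isGreatest_aAlphaIndex`. -/
noncomputable def aAlphaIndex {V : Type*} [Fintype V] (G : SimpleGraph V) (α : ℝ) : ℝ :=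
  sSup {μ : ℝ | Module.End.HasEigenvalue (Matrix.toLin' (aAlphaMatrix G α)) μ}

theorem isHermitian_aAlphaMatrix {V : Type*} [Fintype V] (G : SimpleGraph V) (α : ℝ) :
    (aAlphaMatrix G α).IsHermitian := by
  classical
  refine Matrix.IsHermitian.ext fun v w => ?_
  by_cases h : v = w
  · subst h; simp
  · simp [aAlphaMatrix, SimpleGraph.degMatrix, h, Ne.symm h,
      SimpleGraph.adj_comm]

open Classical in
theorem isGreatest_aAlphaIndex {V : Type*} [Fintype V] [Nonempty V] (G : SimpleGraph V) (α : ℝ) :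
    IsGreatest {μ : ℝ | Module.End.HasEigenvalue (Matrix.toLin' (aAlphaMatrix G α)) μ}
      (aAlphaIndex G α) := by
  have hs : {μ : ℝ | Module.End.HasEigenvalue (Matrix.toLin' (aAlphaMatrix G α)) μ} =
      Set.range (isHermitian_aAlphaMatrix G α).eigenvalues := by
    ext μ
    rw [← Matrix.IsHermitian.spectrum_real_eq_range_eigenvalues, Set.mem_ofPred_eq,
      Module.End.hasEigenvalue_iff_mem_spectrum, Matrix.spectrum_toLin']
  have hne : {μ : ℝ | Module.End.HasEigenvalue (Matrix.toLin' (aAlphaMatrix G α)) μ}.Nonempty := by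
    rw [hs]; exact Set.range_nonempty _
  have hfin : {μ : ℝ | Module.End.HasEigenvalue (Matrix.toLin' (aAlphaMatrix G α)) μ}.Finite := by
    rw [hs]; exact Set.finite_range _
  exact ⟨hne.csSup_mem hfin, fun μ hμ => le_csSup hfin.bddAbove hμ⟩

/-- The star `K_{1,i}` (with centre `Sum.inl ()` and leaves `Fin i`) with a pendant edge attached to
each of its first `m` leaves; the new end of the `b`-th pendant edge is the `b`-th element
of `Fin m`. This is meant for `m ≤ i`. -/
def starWithPendants (i m : ℕ) : SimpleGraph (Unit ⊕ (Fin i ⊕ Fin m)) :=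
  SimpleGraph.fromRel fun x y =>
    match x, y with
    | Sum.inl _, Sum.inr (Sum.inl _) => True
    | Sum.inr (Sum.inl a), Sum.inr (Sum.inr b) => (a : ℕ) = (b : ℕ)
    | _, _ => False

/-- The graph `S*_{n,i}`: the star `K_{1,i}` with a pendant edge attached to each of `n - i - 1` of
its leaves. -/
abbrev sStar (n i : ℕ) : SimpleGraph (Unit ⊕ (Fin i ⊕ Fin (n - i - 1))) :=
  starWithPendants i (n - i - 1)

/-! Part (a): the colour classes `X`, `Y` of `G`, of sizes `a + b = n`, are independent, so `a, b ≤
i`. Let `ρ` be the `bipartiteRoot` of `K_{i,n-i}`. The positive vector equal to `(1 - α) b` on `X`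
and `ρ - α b` on `Y` satisfies `A_α z ≤ ρ z` entrywise, because `ab - i(n - i) = (i - a)(i - b) ≥ 0`
and `2α - 1 ≥ 0`. Pairing it with a nonnegative top eigenvector gives `λ_α(G) ≤ ρ`
(`mulVec_le_of_supersolution`). Equality forces every degree to be full, so `G = K_{a,b}`, and its
independence number gives `max a b = i`.

Part (b): root `T` at a vertex `u` where a positive top eigenvector `x` is largest. The forest `T -
u` has `n - 1` vertices and no independent set larger than `i`, so a König-type argument
(`IsRootedBy.exists_matching`) yields a matching with at least `n - 1 - i` edges. Keeping `n - i -
1` of these edges and joining every other vertex to `u` produces `S*_{n,i}`. Each moved edge now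
ends at the maximum of `x`, so the quadratic form at `x` does not drop
(`IsRootedBy.aAlphaIndex_le`). -/

open Matrix

/-! ### Rayleigh quotients and Perron–Frobenius facts for `A_α`. -/

section Spectral

variable {V : Type*} [Fintype V] {G : SimpleGraph V} {α : ℝ}

open Classical in
theorem aAlphaMatrix_mulVec_apply (G : SimpleGraph V) (α : ℝ) (x : V → ℝ) (v : V) :
    (aAlphaMatrix G α *ᵥ x) v = ∑ w, if G.Adj v w then α * x v + (1 - α) * x w else 0 := by
  rw [aAlphaMatrix, add_mulVec, smul_mulVec, smul_mulVec]
  simp only [Pi.add_apply, Pi.smul_apply, SimpleGraph.degMatrix_mulVec_apply,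
    SimpleGraph.adjMatrix_mulVec_apply, smul_eq_mul]
  rw [← Finset.sum_filter, Finset.sum_add_distrib, Finset.sum_const, ← Finset.mul_sum,
    ← SimpleGraph.neighborFinset_eq_filter, SimpleGraph.card_neighborFinset_eq_degree]
  simp only [nsmul_eq_mul]
  ring

open Classical in
theorem dotProduct_aAlphaMatrix_mulVec (G : SimpleGraph V) (α : ℝ) (x : V → ℝ) :
    x ⬝ᵥ aAlphaMatrix G α *ᵥ x =
      ∑ v, ∑ w, if G.Adj v w then α * (x v * x v) + (1 - α) * (x v * x w) else 0 := by
  refine Finset.sum_congr rfl fun v _ => ?_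
  rw [aAlphaMatrix_mulVec_apply, Finset.mul_sum]
  refine Finset.sum_congr rfl fun w _ => ?_
  split_ifs <;> ring

open Classical in
theorem hasEigenvalue_toLin'_iff (A : Matrix V V ℝ) (μ : ℝ) :
    Module.End.HasEigenvalue (Matrix.toLin' A) μ ↔ ∃ x, x ≠ 0 ∧ A *ᵥ x = μ • x := by
  constructor
  · intro h
    obtain ⟨x, hx⟩ := h.exists_hasEigenvector
    exact ⟨x, hx.2, by simpa using hx.apply_eq_smul⟩
  · rintro ⟨x, hx, h⟩
    exact Module.End.hasEigenvalue_of_hasEigenvector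
      (Module.End.hasEigenvector_iff.2 ⟨Module.End.mem_eigenspace_iff.2 (by simpa using h), hx⟩)

theorem le_aAlphaIndex_of_mulVec_eq [Nonempty V] {μ : ℝ} {x : V → ℝ} (hx : x ≠ 0)
    (h : aAlphaMatrix G α *ᵥ x = μ • x) : μ ≤ aAlphaIndex G α :=
  (isGreatest_aAlphaIndex G α).2 ((hasEigenvalue_toLin'_iff _ _).2 ⟨x, hx, h⟩)

-- An eigenvalue `μ` of `λI - A_α` yields the eigenvalue `λ - μ` of `A_α`, and `λ` is the largest.
-- This gives the Rayleigh bound and its equality case.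
open Classical in
theorem posSemidef_aAlphaIndex_sub [Nonempty V] (G : SimpleGraph V) (α : ℝ) :
    (aAlphaIndex G α • (1 : Matrix V V ℝ) - aAlphaMatrix G α).PosSemidef := by
  have hH : (aAlphaIndex G α • (1 : Matrix V V ℝ) - aAlphaMatrix G α).IsHermitian := by
    refine Matrix.IsHermitian.sub ?_ (isHermitian_aAlphaMatrix G α)
    simp [Matrix.IsHermitian]
  rw [hH.posSemidef_iff_eigenvalues_nonneg]
  intro j
  have h := hH.mulVec_eigenvectorBasis j
  set μ := hH.eigenvalues j
  set y : V → ℝ := ⇑(hH.eigenvectorBasis j)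
  have hy : y ≠ 0 := by
    intro h0
    apply hH.eigenvectorBasis.orthonormal.ne_zero j
    ext v
    exact congrFun h0 v
  rw [sub_mulVec, smul_mulVec, one_mulVec] at h
  have h2 : aAlphaMatrix G α *ᵥ y = (aAlphaIndex G α - μ) • y := by
    rw [sub_smul, ← h]; abel
  have := le_aAlphaIndex_of_mulVec_eq hy h2
  simpa using this

theorem dotProduct_mulVec_le_aAlphaIndex [Nonempty V] (G : SimpleGraph V) (α : ℝ) (x : V → ℝ) :
    x ⬝ᵥ aAlphaMatrix G α *ᵥ x ≤ aAlphaIndex G α * (x ⬝ᵥ x) := by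
  classical
  have h := (posSemidef_iff_dotProduct_mulVec.1 (posSemidef_aAlphaIndex_sub G α)).2 x
  rw [sub_mulVec, smul_mulVec, one_mulVec, dotProduct_sub, dotProduct_smul, star_trivial,
    smul_eq_mul] at h
  linarith

theorem mulVec_eq_of_aAlphaIndex_le [Nonempty V] {x : V → ℝ}
    (hx : aAlphaIndex G α * (x ⬝ᵥ x) ≤ x ⬝ᵥ aAlphaMatrix G α *ᵥ x) :
    aAlphaMatrix G α *ᵥ x = aAlphaIndex G α • x := by
  classical
  have h := ((posSemidef_aAlphaIndex_sub G α).dotProduct_mulVec_zero_iff x).1 (by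
    rw [sub_mulVec, smul_mulVec, one_mulVec, dotProduct_sub, dotProduct_smul, star_trivial,
      smul_eq_mul]
    linarith [dotProduct_mulVec_le_aAlphaIndex G α x])
  rw [sub_mulVec, smul_mulVec, one_mulVec] at h
  exact (sub_eq_zero.1 h).symm

/-- The `A_α`-index has a nonnegative eigenvector. -/
theorem exists_nonneg_eigenvector [Nonempty V] (G : SimpleGraph V) (hα : α ≤ 1) :
    ∃ x : V → ℝ, x ≠ 0 ∧ (∀ v, 0 ≤ x v) ∧ aAlphaMatrix G α *ᵥ x = aAlphaIndex G α • x := by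
  classical
  obtain ⟨y, hy, h⟩ := (hasEigenvalue_toLin'_iff _ _).1 (isGreatest_aAlphaIndex G α).1
  -- Taking absolute values keeps the norm and does not lower the quadratic form, since the
  -- off-diagonal entries are nonnegative; so `|y|` also attains the maximum.
  refine ⟨fun v => |y v|, ?_, fun v => abs_nonneg _, mulVec_eq_of_aAlphaIndex_le ?_⟩
  · intro h0
    exact hy (funext fun v => abs_eq_zero.1 (congrFun h0 v))
  · have h1 : (fun v => |y v|) ⬝ᵥ (fun v => |y v|) = y ⬝ᵥ y :=
      Finset.sum_congr rfl fun v _ => abs_mul_abs_self _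
    have h2 : aAlphaIndex G α * (y ⬝ᵥ y) = y ⬝ᵥ aAlphaMatrix G α *ᵥ y := by
      rw [h, dotProduct_smul, smul_eq_mul]
    rw [h1, h2, dotProduct_aAlphaMatrix_mulVec, dotProduct_aAlphaMatrix_mulVec]
    refine Finset.sum_le_sum fun v _ => Finset.sum_le_sum fun w _ => ?_
    split_ifs
    · rw [abs_mul_abs_self, ← abs_mul]
      have := mul_le_mul_of_nonneg_left (le_abs_self (y v * y w)) (sub_nonneg.2 hα)
      linarith
    · exact le_rfl

/-- A nonnegative eigenvector vanishing at a vertex vanishes at its neighbours. -/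
theorem eq_zero_of_adj_of_mulVec_eq {x : V → ℝ} {μ : ℝ} (hα : α < 1) (hx : ∀ v, 0 ≤ x v)
    (h : aAlphaMatrix G α *ᵥ x = μ • x) {v w : V} (hv : x v = 0) (hvw : G.Adj v w) : x w = 0 := by
  classical
  have h1 := congrFun h v
  rw [aAlphaMatrix_mulVec_apply, Pi.smul_apply, hv, smul_zero, Finset.sum_eq_zero_iff_of_nonneg] at h1
  · have h2 := h1 w (Finset.mem_univ _)
    rw [if_pos hvw] at h2
    have : (1 - α) ≠ 0 := by linarith
    simpa [this] using h2
  · intro w _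
    have := mul_nonneg (sub_nonneg.2 hα.le) (hx w)
    split_ifs <;> simp [this]

theorem eq_zero_of_reachable_of_mulVec_eq {x : V → ℝ} {μ : ℝ} (hα : α < 1) (hx : ∀ v, 0 ≤ x v)
    (h : aAlphaMatrix G α *ᵥ x = μ • x) {v w : V} (hv : x v = 0) (hvw : G.Reachable v w) :
    x w = 0 := by
  obtain ⟨p⟩ := hvw
  induction p with
  | nil => exact hv
  | cons hadj _ ih => exact ih (eq_zero_of_adj_of_mulVec_eq hα hx h hv hadj)

/-- The `A_α`-index of a connected graph has a positive eigenvector. -/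
theorem exists_pos_eigenvector (hG : G.Connected) (hα : α < 1) :
    ∃ x : V → ℝ, (∀ v, 0 < x v) ∧ aAlphaMatrix G α *ᵥ x = aAlphaIndex G α • x := by
  have := hG.nonempty
  obtain ⟨x, hx0, hx, h⟩ := exists_nonneg_eigenvector G hα.le
  refine ⟨x, fun v => (hx v).lt_of_ne fun hv => hx0 (funext fun w => ?_), h⟩
  exact eq_zero_of_reachable_of_mulVec_eq hα hx h hv.symm (hG.preconnected v w)

theorem aAlphaIndex_congr {W : Type*} [Fintype W] {H : SimpleGraph W} (e : G ≃g H) (α : ℝ) :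
    aAlphaIndex G α = aAlphaIndex H α := by
  classical
  have key : ∀ x : W → ℝ, aAlphaMatrix G α *ᵥ (x ∘ e) = (aAlphaMatrix H α *ᵥ x) ∘ e := by
    intro x
    ext v
    change _ = (aAlphaMatrix H α *ᵥ x) (e v)
    rw [aAlphaMatrix_mulVec_apply, aAlphaMatrix_mulVec_apply, ← e.toEquiv.sum_comp]
    refine Finset.sum_congr rfl fun w _ => ?_
    simp [e.map_adj_iff]
  rw [aAlphaIndex, aAlphaIndex]
  congr 1
  ext μ
  simp only [Set.mem_ofPred_eq, hasEigenvalue_toLin'_iff]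
  constructor
  · rintro ⟨x, hx, h⟩
    refine ⟨x ∘ e.symm, fun h0 => hx (funext fun v => ?_), ?_⟩
    · simpa using congrFun h0 (e v)
    · ext w
      obtain ⟨v, rfl⟩ := e.surjective w
      have := congrFun (key (x ∘ e.symm)) v
      have h3 : (x ∘ e.symm) ∘ e = x := by ext; simp
      rw [h3, h] at this
      simpa using this.symm
  · rintro ⟨x, hx, h⟩
    refine ⟨x ∘ e, fun h0 => hx (funext fun v => ?_), ?_⟩
    · simpa using congrFun h0 (e.symm v)
    · rw [key, h]; rfl

end Spectral

/-! ### Bipartite graphs with given independence number. -/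

section Bipartite

theorem completeBipartiteGraph_isBipartite (V W : Type*) :
    (completeBipartiteGraph V W).IsBipartite :=
  ⟨(SimpleGraph.recolorOfEquiv _ finTwoEquiv.symm)
    (SimpleGraph.CompleteBipartiteGraph.bicoloring V W)⟩

theorem completeBipartiteGraph_connected (V W : Type*) [Nonempty V] [Nonempty W] :
    (completeBipartiteGraph V W).Connected := by
  obtain ⟨a⟩ := ‹Nonempty V›
  obtain ⟨b⟩ := ‹Nonempty W›
  have hr : ∀ w, (completeBipartiteGraph V W).Reachable (Sum.inl a) (Sum.inr w) := fun w =>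
    SimpleGraph.Adj.reachable (by simp)
  have hl : ∀ v, (completeBipartiteGraph V W).Reachable (Sum.inl v) (Sum.inr b) := fun v =>
    SimpleGraph.Adj.reachable (by simp)
  have h : ∀ x, (completeBipartiteGraph V W).Reachable (Sum.inl a) x := by
    rintro (v | w)
    · exact (hr b).trans (hl v).symm
    · exact hr w
  have : Nonempty (V ⊕ W) := ⟨Sum.inl a⟩
  exact SimpleGraph.Connected.mk fun x y => (h x).symm.trans (h y)

theorem indepNum_completeBipartiteGraph {i j : ℕ} (hij : j ≤ i) :
    (completeBipartiteGraph (Fin i) (Fin j)).indepNum = i := by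
  classical
  apply le_antisymm
  · obtain ⟨s, hs, hc⟩ :=
      (completeBipartiteGraph (Fin i) (Fin j)).exists_isNIndepSet_indepNum
    rw [← hc]
    by_cases h : ∃ v, Sum.inl v ∈ s
    · obtain ⟨v, hv⟩ := h
      have hsub : s ⊆ Finset.univ.map (Function.Embedding.inl (β := Fin j)) := by
        rintro (a | b) hx
        · simp
        · exact absurd (by simp) (hs hv hx (by simp))
      simpa using Finset.card_le_card hsub
    · have hsub : s ⊆ Finset.univ.map (Function.Embedding.inr (α := Fin i)) := by
        rintro (a | b) hx
        · exact absurd ⟨a, hx⟩ h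
        · simp
      exact le_trans (by simpa using Finset.card_le_card hsub) hij
  · have h : (completeBipartiteGraph (Fin i) (Fin j)).IsIndepSet
        (Finset.univ.map (Function.Embedding.inl (α := Fin i) (β := Fin j)) : Set (Fin i ⊕ Fin j)) := by
      intro x hx y hy _
      simp only [Finset.coe_map, Set.mem_image, Finset.mem_coe] at hx hy
      obtain ⟨a, _, rfl⟩ := hx
      obtain ⟨b, _, rfl⟩ := hy
      simp
    simpa using h.card_le_indepNum

/-- The larger root of `t² - α (i + j) t + (2 α - 1) i j`. -/
noncomputable def bipartiteRoot (α i j : ℝ) : ℝ :=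
  (α * (i + j) + √(α ^ 2 * (i - j) ^ 2 + 4 * (1 - α) ^ 2 * (i * j))) / 2

theorem bipartiteRoot_spec {α i j : ℝ} (hi : 0 ≤ i) (hj : 0 ≤ j) :
    (bipartiteRoot α i j - α * i) * (bipartiteRoot α i j - α * j) = (1 - α) ^ 2 * (i * j) := by
  have h := Real.sq_sqrt (show 0 ≤ α ^ 2 * (i - j) ^ 2 + 4 * (1 - α) ^ 2 * (i * j) by positivity)
  rw [bipartiteRoot]
  linear_combination h / 4

/-- Ensures that the entry `ρ - α b` of the test vector is positive when `b ≤ i`. -/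
theorem lt_bipartiteRoot {α i j : ℝ} (hα : α < 1) (hi : 0 < i) (hj : 0 < j) :
    α * i < bipartiteRoot α i j := by
  have h : α * (i - j) < √(α ^ 2 * (i - j) ^ 2 + 4 * (1 - α) ^ 2 * (i * j)) := by
    apply Real.lt_sqrt_of_sq_lt
    have : 0 < 1 - α := by linarith
    have : 0 < 4 * (1 - α) ^ 2 * (i * j) := by positivity
    nlinarith
  rw [bipartiteRoot]
  linarith

theorem bipartiteRoot_le_aAlphaIndex {α : ℝ} (hα : α < 1) {i j : ℕ} (hi : 0 < i) (hj : 0 < j) :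
    bipartiteRoot α i j ≤ aAlphaIndex (completeBipartiteGraph (Fin i) (Fin j)) α := by
  classical
  have hi' : (0 : ℝ) < i := by exact_mod_cast hi
  have hj' : (0 : ℝ) < j := by exact_mod_cast hj
  have : Nonempty (Fin i ⊕ Fin j) := ⟨Sum.inl ⟨0, hi⟩⟩
  have hspec := bipartiteRoot_spec (α := α) hi'.le hj'.le
  apply le_aAlphaIndex_of_mulVec_eq
    (x := Sum.elim (fun _ => (1 - α) * j) (fun _ => bipartiteRoot α i j - α * j))
  · intro h
    have := congrFun h (Sum.inl ⟨0, hi⟩)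
    have : (1 - α) * j = 0 := by simpa using this
    have : 0 < (1 - α) * j := mul_pos (by linarith) hj'
    linarith
  · ext v
    rw [aAlphaMatrix_mulVec_apply, Fintype.sum_sum_type]
    rcases v with v | v
    · simp
      ring
    · simp
      linear_combination -hspec

open Classical in
/-- A nonnegative vector that is a top eigenvector is supported where a positive supersolution is
tight. -/
theorem mulVec_le_of_supersolution {V : Type*} [Fintype V] [Nonempty V] {G : SimpleGraph V} {α ρ : ℝ}
    (hα : α < 1) {z : V → ℝ} (hz : ∀ v, 0 < z v) (h : ∀ v, (aAlphaMatrix G α *ᵥ z) v ≤ ρ * z v) :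
    aAlphaIndex G α ≤ ρ ∧ (aAlphaIndex G α = ρ → ∃ S : Set V, S.Nonempty ∧
      (∀ v ∈ S, (aAlphaMatrix G α *ᵥ z) v = ρ * z v) ∧ ∀ v ∈ S, ∀ w, G.Adj v w → w ∈ S) := by
  obtain ⟨x, hx0, hx, hxe⟩ := exists_nonneg_eigenvector G hα.le
  obtain ⟨u, hu⟩ := Function.ne_iff.1 hx0
  have hpos : 0 < x ⬝ᵥ z := by
    refine Finset.sum_pos' (fun v _ => mul_nonneg (hx v) (hz v).le) ⟨u, Finset.mem_univ _, ?_⟩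
    exact mul_pos ((hx u).lt_of_ne (Ne.symm hu)) (hz u)
  -- By symmetry the matrix can act on the eigenvector `x` instead of on `z`.
  have hsymm : x ⬝ᵥ aAlphaMatrix G α *ᵥ z = aAlphaIndex G α * (x ⬝ᵥ z) := by
    have hT : (aAlphaMatrix G α)ᵀ = aAlphaMatrix G α := by
      simpa using (isHermitian_aAlphaMatrix G α).eq
    rw [dotProduct_mulVec, ← mulVec_transpose, hT, hxe, smul_dotProduct, smul_eq_mul]
  have hterm : ∀ v, x v * (aAlphaMatrix G α *ᵥ z) v ≤ ρ * (x v * z v) := fun v => by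
    have := mul_le_mul_of_nonneg_left (h v) (hx v)
    linarith
  have hρ : ρ * (x ⬝ᵥ z) = ∑ v, ρ * (x v * z v) := by rw [dotProduct, Finset.mul_sum]
  -- `S` is the support of `x`. It is closed under adjacency because zeros of `x` spread to
  -- neighbours; without connectedness it need not be all of `V`.
  refine ⟨?_, fun heq => ⟨{v | x v ≠ 0}, ⟨u, hu⟩, ?_, ?_⟩⟩
  · refine le_of_mul_le_mul_right ?_ hpos
    rw [← hsymm, hρ]
    exact Finset.sum_le_sum fun v _ => hterm v
  · intro v hv
    have h1 : ∑ v, x v * (aAlphaMatrix G α *ᵥ z) v = ∑ v, ρ * (x v * z v) := by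
      rw [← hρ, ← heq, ← hsymm]; rfl
    have h2 := (Finset.sum_eq_sum_iff_of_le fun v _ => hterm v).1 h1 v (Finset.mem_univ _)
    exact mul_left_cancel₀ hv (by linarith)
  · intro v hv w hvw hw
    exact hv (eq_zero_of_adj_of_mulVec_eq hα hx hxe hw hvw.symm)

open Classical in
theorem aAlphaIndex_le_bipartiteRoot {α : ℝ} (hα0 : 1 / 2 ≤ α) (hα : α < 1) {n i : ℕ}
    (hij : n ≤ 2 * i) (hin : i < n) {V : Type*} [Fintype V] {G : SimpleGraph V}
    (hn : Fintype.card V = n) (hG : G.IsBipartite) (hind : G.indepNum = i) :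
    aAlphaIndex G α ≤ bipartiteRoot α i (n - i : ℕ) ∧
      (aAlphaIndex G α = bipartiteRoot α i (n - i : ℕ) →
        Nonempty (G ≃g completeBipartiteGraph (Fin i) (Fin (n - i)))) := by
  obtain ⟨c⟩ := hG
  have : Nonempty V := Fintype.card_pos_iff.1 (by omega)
  set X : Finset V := Finset.univ.filter fun v => c v = 0 with hX
  set Y : Finset V := Finset.univ.filter fun v => ¬ c v = 0 with hY
  have hc1 : ∀ {v w}, G.Adj v w → c v = 0 → ¬ c w = 0 := fun h h1 h2 => c.valid h (h1.trans h2.symm)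
  have hc2 : ∀ {v w}, G.Adj v w → ¬ c v = 0 → c w = 0 := fun {v w} h h1 => by
    have := c.valid h
    omega
  have hXi : X.card ≤ i := by
    rw [← hind]
    refine SimpleGraph.IsIndepSet.card_le_indepNum fun v hv w hw _ h => ?_
    exact hc1 h (by simpa [hX] using hv) (by simpa [hX] using hw)
  have hYi : Y.card ≤ i := by
    rw [← hind]
    refine SimpleGraph.IsIndepSet.card_le_indepNum fun v hv w hw _ h => ?_
    have h1 : ¬ c v = 0 := by simpa [hY] using hv
    exact (by simpa [hY] using hw : ¬ c w = 0) (hc2 h h1)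
  have hXY : X.card + Y.card = n := by
    rw [← hn]; exact Finset.card_filter_add_card_filter_not _
  set ρ := bipartiteRoot α i (n - i : ℕ) with hρ
  have hi0 : (0 : ℝ) < i := by exact_mod_cast (by omega : 0 < i)
  have hj0 : (0 : ℝ) < (n - i : ℕ) := by exact_mod_cast (by omega : 0 < n - i)
  have hspec := bipartiteRoot_spec (α := α) hi0.le hj0.le
  have hlt := lt_bipartiteRoot hα hi0 hj0
  rw [← hρ] at hspec hlt
  have hcast : ((n - i : ℕ) : ℝ) = n - i := by rw [Nat.cast_sub hin.le]
  have ha : (X.card : ℝ) ≤ i := by exact_mod_cast hXi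
  have hb : (Y.card : ℝ) ≤ i := by exact_mod_cast hYi
  have ha0 : (0 : ℝ) < X.card := by exact_mod_cast (by omega : 0 < X.card)
  have hb0 : (0 : ℝ) < Y.card := by exact_mod_cast (by omega : 0 < Y.card)
  have hab : (X.card : ℝ) + Y.card = n := by exact_mod_cast hXY
  have hα1 : 0 < 1 - α := by linarith
  have hρb : 0 < ρ - α * Y.card := by nlinarith
  -- The quadratics of `K_{a,b}` and `K_{i,n-i}` differ by the constant `(2α - 1)(i - a)(i - b)`,
  -- and the latter vanishes at `ρ`. This is where `α ≥ 1/2` enters.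
  have hkey : (1 - α) ^ 2 * (X.card * Y.card) ≤ (ρ - α * X.card) * (ρ - α * Y.card) := by
    rw [hcast] at hspec
    have h1 : (0 : ℝ) ≤ (i - X.card) * (i - Y.card) := mul_nonneg (by linarith) (by linarith)
    have h2 : 0 ≤ (2 * α - 1) * ((i - X.card) * (i - Y.card)) := mul_nonneg (by linarith) h1
    have hYe : (Y.card : ℝ) = n - X.card := by linarith
    rw [hYe] at h2 ⊢
    nlinarith
  -- For `K_{a,b}` the rows in `X` hold with equality, and those in `Y` reduce to `hkey`; smaller
  -- degrees in `G` only decrease the left side.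
  let z : V → ℝ := fun v => if c v = 0 then (1 - α) * Y.card else ρ - α * Y.card
  have hz : ∀ v, 0 < z v := fun v => by
    simp only [z]; split_ifs
    · exact mul_pos hα1 hb0
    · exact hρb
  have hzX : ∀ v, c v = 0 → (aAlphaMatrix G α *ᵥ z) v =
      G.degree v * (α * ((1 - α) * Y.card) + (1 - α) * (ρ - α * Y.card)) := fun v hv => by
    rw [aAlphaMatrix_mulVec_apply, ← Finset.sum_filter, ← SimpleGraph.neighborFinset_eq_filter,
      ← SimpleGraph.card_neighborFinset_eq_degree, ← nsmul_eq_mul]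
    refine Finset.sum_eq_card_nsmul fun w hw => ?_
    simp [z, hv, hc1 ((SimpleGraph.mem_neighborFinset _ _ _).1 hw) hv]
  have hzY : ∀ v, ¬ c v = 0 → (aAlphaMatrix G α *ᵥ z) v =
      G.degree v * (α * (ρ - α * Y.card) + (1 - α) * ((1 - α) * Y.card)) := fun v hv => by
    rw [aAlphaMatrix_mulVec_apply, ← Finset.sum_filter, ← SimpleGraph.neighborFinset_eq_filter,
      ← SimpleGraph.card_neighborFinset_eq_degree, ← nsmul_eq_mul]
    refine Finset.sum_eq_card_nsmul fun w hw => ?_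
    simp [z, hv, hc2 ((SimpleGraph.mem_neighborFinset _ _ _).1 hw) hv]
  have hNX : ∀ v, c v = 0 → G.neighborFinset v ⊆ Y := fun v hv w hw => by
    simp [hY, hc1 ((SimpleGraph.mem_neighborFinset _ _ _).1 hw) hv]
  have hNY : ∀ v, ¬ c v = 0 → G.neighborFinset v ⊆ X := fun v hv w hw => by
    simp [hX, hc2 ((SimpleGraph.mem_neighborFinset _ _ _).1 hw) hv]
  have hdX : ∀ v, c v = 0 → (G.degree v : ℝ) ≤ Y.card := fun v hv => by
    exact_mod_cast Finset.card_le_card (hNX v hv)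
  have hdY : ∀ v, ¬ c v = 0 → (G.degree v : ℝ) ≤ X.card := fun v hv => by
    exact_mod_cast Finset.card_le_card (hNY v hv)
  have hα00 : 0 < α := by linarith
  have hfX : 0 < α * ((1 - α) * Y.card) + (1 - α) * (ρ - α * Y.card) := by positivity
  have hfY : 0 < α * (ρ - α * Y.card) + (1 - α) * ((1 - α) * Y.card) := by positivity
  have hsupX : (Y.card : ℝ) * (α * ((1 - α) * Y.card) + (1 - α) * (ρ - α * Y.card)) =
      ρ * ((1 - α) * Y.card) := by ring
  have hsupY : (X.card : ℝ) * (α * (ρ - α * Y.card) + (1 - α) * ((1 - α) * Y.card)) ≤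
      ρ * (ρ - α * Y.card) := by linarith
  obtain ⟨hle, heq⟩ := mulVec_le_of_supersolution (G := G) (ρ := ρ) hα hz (fun v => by
    by_cases hv : c v = 0
    · rw [hzX v hv, show z v = (1 - α) * Y.card from if_pos hv, ← hsupX]
      exact mul_le_mul_of_nonneg_right (hdX v hv) hfX.le
    · rw [hzY v hv, show z v = ρ - α * Y.card from if_neg hv]
      exact (mul_le_mul_of_nonneg_right (hdY v hv) hfY.le).trans hsupY)
  refine ⟨hle, fun h => ?_⟩
  obtain ⟨S, ⟨u, hu⟩, hSe, hSc⟩ := heq h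
  have hfullX : ∀ v ∈ S, c v = 0 → G.neighborFinset v = Y := fun v hv hcv => by
    refine Finset.eq_of_subset_of_card_le (hNX v hcv) ?_
    have h1 := hSe v hv
    rw [hzX v hcv, show z v = (1 - α) * Y.card from if_pos hcv, ← hsupX] at h1
    have h2 := mul_right_cancel₀ hfX.ne' h1
    rw [SimpleGraph.card_neighborFinset_eq_degree]
    exact_mod_cast h2.ge
  have hfullY : ∀ v ∈ S, ¬ c v = 0 → G.neighborFinset v = X := fun v hv hcv => by
    refine Finset.eq_of_subset_of_card_le (hNY v hcv) ?_
    have h1 := hSe v hv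
    rw [hzY v hcv, show z v = ρ - α * Y.card from if_neg hcv] at h1
    have h2 := le_of_mul_le_mul_right (hsupY.trans h1.ge) hfY
    rw [SimpleGraph.card_neighborFinset_eq_degree]
    exact_mod_cast h2
  have hS1 : ∀ v ∈ S, c v = 0 → ∀ w, ¬ c w = 0 → w ∈ S := fun v hv hcv w hw => by
    refine hSc v hv w ((SimpleGraph.mem_neighborFinset _ _ _).1 ?_)
    rw [hfullX v hv hcv]; simp [hY, hw]
  have hS2 : ∀ v ∈ S, ¬ c v = 0 → ∀ w, c w = 0 → w ∈ S := fun v hv hcv w hw => by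
    refine hSc v hv w ((SimpleGraph.mem_neighborFinset _ _ _).1 ?_)
    rw [hfullY v hv hcv]; simp [hX, hw]
  obtain ⟨a, haX⟩ := Finset.card_pos.1 (by exact_mod_cast ha0 : 0 < X.card)
  obtain ⟨b, hbY⟩ := Finset.card_pos.1 (by exact_mod_cast hb0 : 0 < Y.card)
  replace haX : c a = 0 := by simpa [hX] using haX
  replace hbY : ¬ c b = 0 := by simpa [hY] using hbY
  -- A vertex of `S` is joined to the whole opposite class, so the nonempty closed set `S` absorbs
  -- both classes.
  have hSall : ∀ v, v ∈ S := by
    have haS : a ∈ S := by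
      by_cases hcu : c u = 0
      · exact hS2 b (hS1 u hu hcu b hbY) hbY a haX
      · exact hS2 u hu hcu a haX
    have hbS := hS1 a haS haX b hbY
    intro v
    by_cases hcv : c v = 0
    · exact hS2 b hbS hbY v hcv
    · exact hS1 a haS haX v hcv
  have hadj : ∀ v w, G.Adj v w ↔ (c v = 0 ∧ ¬ c w = 0) ∨ (¬ c v = 0 ∧ c w = 0) := fun v w => by
    rw [← SimpleGraph.mem_neighborFinset]
    by_cases hcv : c v = 0
    · rw [hfullX v (hSall v) hcv]; simp [hY, hcv]
    · rw [hfullY v (hSall v) hcv]; simp [hX, hcv]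
  -- one part has size `i`
  have hpart : X.card = i ∨ Y.card = i := by
    obtain ⟨s, hs, hcs⟩ := G.exists_isNIndepSet_indepNum
    rw [hind] at hcs
    by_cases h0 : ∃ v ∈ s, c v = 0
    · obtain ⟨v, hv, hcv⟩ := h0
      refine Or.inl (le_antisymm hXi (hcs ▸ Finset.card_le_card fun w hw => ?_))
      by_contra hcw
      have hcw : ¬ c w = 0 := by simpa [hX] using hcw
      exact hs hv hw (by rintro rfl; exact hcw hcv) ((hadj v w).2 (Or.inl ⟨hcv, hcw⟩))
    · refine Or.inr (le_antisymm hYi (hcs ▸ Finset.card_le_card fun w hw => ?_))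
      simp only [hY, Finset.mem_filter, Finset.mem_univ, true_and]
      exact fun h1 => h0 ⟨w, hw, h1⟩
  rcases hpart with hp | hp
  · let e1 : {v // c v = 0} ≃ Fin i := Fintype.equivFinOfCardEq (by
      rw [Fintype.card_subtype]; exact hp)
    let e2 : {v // ¬ c v = 0} ≃ Fin (n - i) := Fintype.equivFinOfCardEq (by
      rw [Fintype.card_subtype]; exact (by omega : Y.card = n - i))
    refine ⟨(Equiv.sumCompl fun v => c v = 0).symm.trans (e1.sumCongr e2), fun {v w} => ?_⟩
    rw [hadj]
    by_cases hcv : c v = 0 <;> by_cases hcw : c w = 0 <;>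
      simp [hcv, hcw, Equiv.sumCompl_symm_apply_of_pos, Equiv.sumCompl_symm_apply_of_neg]
  · let e1 : {v // c v = 0} ≃ Fin (n - i) := Fintype.equivFinOfCardEq (by
      rw [Fintype.card_subtype]; exact (by omega : X.card = n - i))
    let e2 : {v // ¬ c v = 0} ≃ Fin i := Fintype.equivFinOfCardEq (by
      rw [Fintype.card_subtype]; exact hp)
    refine ⟨((Equiv.sumCompl fun v => c v = 0).symm.trans (e1.sumCongr e2)).trans
      (Equiv.sumComm _ _), fun {v w} => ?_⟩
    rw [hadj]
    by_cases hcv : c v = 0 <;> by_cases hcw : c w = 0 <;>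
      simp [hcv, hcw, Equiv.sumCompl_symm_apply_of_pos, Equiv.sumCompl_symm_apply_of_neg]

end Bipartite

/-! ### Trees as parent functions, and matchings in rooted forests. -/

section RootedTree

/-- `G` is the graph whose edges join each vertex other than the root `u` to its parent `p v`, where
the parent function decreases the depth `d`. -/
structure IsRootedBy {V : Type*} (G : SimpleGraph V) (u : V) (p : V → V) (d : V → ℕ) : Prop where
  depth_lt : ∀ v, v ≠ u → d (p v) < d v
  adj_iff : ∀ v w, G.Adj v w ↔ (v ≠ u ∧ p v = w) ∨ (w ≠ u ∧ p w = v)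

theorem isRootedBy_fromRel {V : Type*} {u : V} {p : V → V} {d : V → ℕ}
    (hd : ∀ v, v ≠ u → d (p v) < d v) :
    IsRootedBy (SimpleGraph.fromRel fun v w => v ≠ u ∧ p v = w) u p d where
  depth_lt := hd
  adj_iff v w := by
    rw [SimpleGraph.fromRel_adj]
    refine ⟨fun h => h.2, fun h => ⟨?_, h⟩⟩
    rintro rfl
    rcases h with ⟨h1, h2⟩ | ⟨h1, h2⟩ <;>
    · have := hd _ h1
      rw [h2] at this
      exact this.false

namespace IsRootedBy

variable {V : Type*} {G : SimpleGraph V} {u : V} {p : V → V} {d : V → ℕ}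

theorem not_both (h : IsRootedBy G u p d) (v w : V) :
    ¬ ((v ≠ u ∧ p v = w) ∧ (w ≠ u ∧ p w = v)) := by
  rintro ⟨⟨h1, h2⟩, h3, h4⟩
  have h5 := h.depth_lt v h1
  have h6 := h.depth_lt w h3
  rw [h2] at h5
  rw [h4] at h6
  exact h5.asymm h6

theorem adj_parent (h : IsRootedBy G u p d) {v : V} (hv : v ≠ u) : G.Adj v (p v) :=
  (h.adj_iff _ _).2 (Or.inl ⟨hv, rfl⟩)

theorem connected (h : IsRootedBy G u p d) : G.Connected := by
  have hr : ∀ (k : ℕ) (v : V), d v ≤ k → G.Reachable v u := by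
    intro k
    induction k with
    | zero =>
      intro v hv
      by_cases hvu : v = u
      · rw [hvu]
      · have := h.depth_lt v hvu
        omega
    | succ k ih =>
      intro v hv
      by_cases hvu : v = u
      · rw [hvu]
      · have := h.depth_lt v hvu
        exact (h.adj_parent hvu).reachable.trans (ih _ (by omega))
  have : Nonempty V := ⟨u⟩
  exact SimpleGraph.Connected.mk fun v w => (hr _ v le_rfl).trans (hr _ w le_rfl).symm

theorem edge_injOn (h : IsRootedBy G u p d) :
    Set.InjOn (fun v => s(v, p v)) {v | v ≠ u} := by
  intro v hv w hw hvw
  rcases Sym2.eq_iff.1 hvw with h1 | h1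
  · exact h1.1
  · exact absurd ⟨⟨hv, h1.2⟩, hw, h1.1.symm⟩ (h.not_both v w)

/-- The parent edges are distinct, so a connected graph on `n` vertices has `n - 1` edges. -/
theorem isTree [Finite V] (h : IsRootedBy G u p d) : G.IsTree := by
  classical
  have := Fintype.ofFinite V
  rw [SimpleGraph.isTree_iff_connected_and_card]
  refine ⟨h.connected, ?_⟩
  have hE : G.edgeSet = (fun v => s(v, p v)) '' {v | v ≠ u} := by
    ext e
    induction e with
    | _ v w =>
      rw [SimpleGraph.mem_edgeSet, h.adj_iff]
      constructor
      · rintro (⟨h1, rfl⟩ | ⟨h1, rfl⟩)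
        · exact ⟨v, h1, rfl⟩
        · exact ⟨w, h1, Sym2.eq_swap⟩
      · rintro ⟨x, hx, hxe⟩
        rcases Sym2.eq_iff.1 hxe with ⟨rfl, h2⟩ | ⟨rfl, h2⟩
        · exact Or.inl ⟨hx, h2⟩
        · exact Or.inr ⟨hx, h2⟩
  rw [hE, Nat.card_image_of_injOn h.edge_injOn, Nat.card_eq_fintype_card, Nat.card_eq_fintype_card]
  have h1 : Fintype.card ↑{v | v ≠ u} = Fintype.card V - 1 := by
    have := Fintype.card_subtype_compl (fun v => v = u)
    rw [Fintype.card_subtype_eq] at this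
    exact this
  have h2 : 0 < Fintype.card V := Fintype.card_pos_iff.2 ⟨u⟩
  omega

/-- Graphs rooted compatibly are isomorphic. -/
theorem nonempty_iso (h : IsRootedBy G u p d) {W : Type*} {H : SimpleGraph W} {u' : W} {p' : W → W}
    {d' : W → ℕ} (h' : IsRootedBy H u' p' d') (e : V ≃ W) (hu : e u = u')
    (hp : ∀ v, v ≠ u → e (p v) = p' (e v)) : Nonempty (G ≃g H) := by
  refine ⟨e, fun {v w} => ?_⟩
  rw [h.adj_iff, h'.adj_iff]
  have hne : ∀ v, e v ≠ u' ↔ v ≠ u := fun v => by rw [← hu, e.injective.ne_iff]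
  have key : ∀ v w, (e v ≠ u' ∧ p' (e v) = e w) ↔ (v ≠ u ∧ p v = w) := fun v w => by
    rw [hne]
    refine and_congr_right fun hv => ?_
    rw [← hp v hv, e.injective.eq_iff]
  rw [key, key]

theorem dotProduct_aAlphaMatrix_mulVec [Fintype V] [DecidableEq V] (h : IsRootedBy G u p d) (α : ℝ)
    (x : V → ℝ) : x ⬝ᵥ aAlphaMatrix G α *ᵥ x =
      ∑ v, if v ≠ u then
        α * (x v * x v + x (p v) * x (p v)) + 2 * (1 - α) * (x v * x (p v)) else 0 := by
  classical
  rw [_root_.dotProduct_aAlphaMatrix_mulVec]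
  have h1 : ∀ v w, (if G.Adj v w then α * (x v * x v) + (1 - α) * (x v * x w) else 0) =
      (if v ≠ u ∧ p v = w then α * (x v * x v) + (1 - α) * (x v * x w) else 0) +
      (if w ≠ u ∧ p w = v then α * (x v * x v) + (1 - α) * (x v * x w) else 0) := fun v w => by
    have := h.not_both v w
    rw [h.adj_iff]
    by_cases h1 : v ≠ u ∧ p v = w
    · have h2 : ¬ (w ≠ u ∧ p w = v) := fun h2 => this ⟨h1, h2⟩
      rw [if_pos (Or.inl h1), if_pos h1, if_neg h2, add_zero]
    · simp only [h1, false_or, if_false, zero_add]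
  simp only [h1, Finset.sum_add_distrib]
  -- Each edge occurs as two ordered pairs; swapping the sums in one family indexes both by the
  -- child.
  rw [Finset.sum_comm (f := fun v w => if w ≠ u ∧ p w = v then _ else _),
    ← Finset.sum_add_distrib]
  refine Finset.sum_congr rfl fun v _ => ?_
  by_cases hv : v = u
  · simp [hv]
  · simp only [ne_eq, hv, not_false_eq_true, true_and, if_true, Finset.sum_ite_eq, Finset.mem_univ]
    ring

end IsRootedBy

/-- A tree can be rooted at any vertex. -/
theorem SimpleGraph.IsTree.exists_isRootedBy {V : Type*} [Finite V] {T : SimpleGraph V}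
    (hT : T.IsTree) (u : V) : ∃ p d, IsRootedBy T u p d := by
  classical
  have := Fintype.ofFinite V
  have hex : ∀ v, ∃ w, v ≠ u → T.Adj v w ∧ T.dist u w < T.dist u v := by
    intro v
    by_cases hv : v = u
    · exact ⟨v, fun h => absurd hv h⟩
    · obtain ⟨q, hq⟩ := hT.connected.exists_walk_length_eq_dist v u
      cases q with
      | nil => exact absurd rfl hv
      | cons hadj q =>
        refine ⟨_, fun _ => ⟨hadj, ?_⟩⟩
        have := SimpleGraph.dist_le q
        rw [SimpleGraph.Walk.length_cons] at hq
        rw [SimpleGraph.dist_comm, SimpleGraph.dist_comm (u := u)]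
        omega
  choose p hp using hex
  refine ⟨p, T.dist u, fun v hv => (hp v hv).2, ?_⟩
  -- The parent is the next vertex on a shortest path to `u`. The parent edges form a spanning tree
  -- inside `T`, and equal edge counts make it all of `T`.
  set R := SimpleGraph.fromRel fun v w => v ≠ u ∧ p v = w
  have hR : IsRootedBy R u p (T.dist u) := isRootedBy_fromRel fun v hv => (hp v hv).2
  have hle : R ≤ T := fun v w hvw => by
    rcases (hR.adj_iff v w).1 hvw with ⟨h1, rfl⟩ | ⟨h1, rfl⟩
    · exact (hp v h1).1
    · exact (hp w h1).1.symm
  have heq : R = T := by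
    have h1 := hR.isTree.card_edgeFinset
    have h2 := hT.card_edgeFinset
    exact SimpleGraph.edgeFinset_inj.1 (Finset.eq_of_subset_of_card_le
      (SimpleGraph.edgeFinset_mono hle) (by omega))
  intro v w
  rw [← heq]
  exact hR.adj_iff v w

/-- A set of non-root vertices contains an independent set together with the lower ends of a matching
whose cardinalities add up to at least that of the given set. -/
theorem IsRootedBy.exists_matching {V : Type*} [DecidableEq V] {G : SimpleGraph V} {u : V} {p : V → V}
    {d : V → ℕ} (h : IsRootedBy G u p d) (U : Finset V) (hU : u ∉ U) :
    ∃ I W : Finset V, I ⊆ U ∧ W ⊆ U ∧ G.IsIndepSet (I : Set V) ∧ (∀ w ∈ W, p w ∈ U ∧ p w ∉ W) ∧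
      Set.InjOn p W ∧ U.card ≤ I.card + W.card := by
  induction U using Finset.strongInduction with
  | H U ih =>
    rcases U.eq_empty_or_nonempty with rfl | hne
    · exact ⟨∅, ∅, by simp⟩
    -- A deepest `v` has no neighbour in `U` except possibly `p v`. Deleting both, `v` joins `I`,
    -- and also `W` when `p v ∈ U`, so every deleted vertex is paid for.
    obtain ⟨v, hv, hmax⟩ := U.exists_max_image d hne
    have hvu : v ≠ u := fun h => hU (h ▸ hv)
    have hchild : ∀ w ∈ U, p w ≠ v := fun w hw hwv => by
      have h1 := h.depth_lt w (fun h => hU (h ▸ hw))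
      rw [hwv] at h1
      exact absurd (hmax w hw) (by omega)
    have hpv : p v ≠ v := hchild v hv
    obtain ⟨I, W, hI, hW, hind, hWp, hinj, hcard⟩ := ih ((U.erase v).erase (p v))
      ((Finset.erase_subset _ _).trans_ssubset (Finset.erase_ssubset hv))
      (fun h => hU (Finset.mem_of_mem_erase (Finset.mem_of_mem_erase h)))
    have hsub : (U.erase v).erase (p v) ⊆ U :=
      (Finset.erase_subset _ _).trans (Finset.erase_subset _ _)
    have hvI : v ∉ I := fun hvI => by simpa using hI hvI
    have hvW : v ∉ W := fun hvW => by simpa using hW hvW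
    have hindep : G.IsIndepSet ((insert v I : Finset V) : Set V) := by
      rw [Finset.coe_insert]
      refine hind.insert fun w hw _ => ?_
      have hw' := hI hw
      have hno : ¬ G.Adj v w := fun hadj => by
        rcases (h.adj_iff v w).1 hadj with ⟨_, h2⟩ | ⟨_, h2⟩
        · simp [← h2] at hw'
        · exact hchild w (hsub hw') h2
      exact ⟨hno, fun h => hno h.symm⟩
    by_cases hpU : p v ∈ U
    · refine ⟨insert v I, insert v W, Finset.insert_subset hv (hI.trans hsub),
        Finset.insert_subset hv (hW.trans hsub), hindep, ?_, ?_, ?_⟩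
      · intro w hw
        rcases Finset.mem_insert.1 hw with rfl | hw
        · refine ⟨hpU, fun hp => ?_⟩
          rcases Finset.mem_insert.1 hp with hp | hp
          · exact hpv hp
          · simpa using hW hp
        · refine ⟨hsub (hWp w hw).1, fun hp => ?_⟩
          rcases Finset.mem_insert.1 hp with hp | hp
          · exact hchild w (hsub (hW hw)) hp
          · exact (hWp w hw).2 hp
      · rw [Finset.coe_insert, Set.injOn_insert (by simpa using hvW)]
        refine ⟨hinj, ?_⟩
        rintro ⟨w, hw, hwv⟩
        have := (hWp w hw).1
        simp [hwv] at this
      · rw [Finset.card_insert_of_notMem hvI, Finset.card_insert_of_notMem hvW]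
        rw [Finset.card_erase_of_mem (Finset.mem_erase.2 ⟨hpv, hpU⟩), Finset.card_erase_of_mem hv]
          at hcard
        omega
    · refine ⟨insert v I, W, Finset.insert_subset hv (hI.trans hsub), hW.trans hsub, hindep,
        fun w hw => ⟨hsub (hWp w hw).1, (hWp w hw).2⟩, hinj, ?_⟩
      rw [Finset.card_insert_of_notMem hvI]
      rw [Finset.erase_eq_of_notMem (fun h => hpU (Finset.mem_of_mem_erase h)),
        Finset.card_erase_of_mem hv] at hcard
      omega

end RootedTree

/-! ### The star with pendant edges: tree structure and independence number. -/

section StarWithPendants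

/-- The parent function of `starWithPendants i m` rooted at its centre. -/
def starParent (i m : ℕ) (hm : m ≤ i) :
    Unit ⊕ (Fin i ⊕ Fin m) → Unit ⊕ (Fin i ⊕ Fin m)
  | Sum.inl _ => Sum.inl ()
  | Sum.inr (Sum.inl _) => Sum.inl ()
  | Sum.inr (Sum.inr b) => Sum.inr (Sum.inl (Fin.castLE hm b))

def starDepth (i m : ℕ) : Unit ⊕ (Fin i ⊕ Fin m) → ℕ
  | Sum.inl _ => 0
  | Sum.inr (Sum.inl _) => 1
  | Sum.inr (Sum.inr _) => 2

theorem isRootedBy_starWithPendants {i m : ℕ} (hm : m ≤ i) :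
    IsRootedBy (starWithPendants i m) (Sum.inl ()) (starParent i m hm) (starDepth i m) where
  depth_lt := by
    rintro (_ | _ | _) h
    · exact absurd rfl h
    · simp [starParent, starDepth]
    · simp [starParent, starDepth]
  adj_iff := by
    rintro (v | v | v) (w | w | w) <;>
      simp [starWithPendants, starParent, Fin.ext_iff, eq_comm]

theorem indepNum_starWithPendants {i m : ℕ} (hm : m < i) : (starWithPendants i m).indepNum = i := by
  classical
  apply le_antisymm
  · obtain ⟨s, hs, hc⟩ := (starWithPendants i m).exists_isNIndepSet_indepNum
    rw [← hc]
    -- The fibres of `f` are `i` cliques: the `m` pendant edges, the centre with the bare leaf `m`,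
    -- and single leaves. An independent set meets each at most once.
    let f : Unit ⊕ (Fin i ⊕ Fin m) → Fin i :=
      Sum.elim (fun _ => ⟨m, hm⟩) (Sum.elim id (Fin.castLE hm.le))
    have hf : Set.InjOn f s := by
      intro v hv w hw hvw
      by_contra hne
      apply hs hv hw hne
      revert hvw hne
      clear hv hw
      rcases v with v | v | v <;> rcases w with w | w | w <;>
        simp [f, starWithPendants, Fin.ext_iff] <;> omega
    simpa using Finset.card_le_card_of_injOn f (fun _ _ => Finset.mem_univ _) hf
  · let g : Fin i → Unit ⊕ (Fin i ⊕ Fin m) := fun a =>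
      if h : (a : ℕ) < m then Sum.inr (Sum.inr ⟨a, h⟩) else Sum.inr (Sum.inl a)
    have hg : Function.Injective g := by
      intro a b hab
      simp only [g] at hab
      split_ifs at hab <;> simp_all [Fin.ext_iff]
    have hind : (starWithPendants i m).IsIndepSet
        (Finset.univ.map ⟨g, hg⟩ : Set (Unit ⊕ (Fin i ⊕ Fin m))) := by
      intro x hx y hy _
      simp only [Finset.coe_map, Set.mem_image, Function.Embedding.coeFn_mk] at hx hy
      obtain ⟨a, _, rfl⟩ := hx
      obtain ⟨b, _, rfl⟩ := hy
      simp only [g]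
      split_ifs <;> simp [starWithPendants] <;> omega
    simpa using hind.card_le_indepNum

end StarWithPendants

/-! ### Reattachment at the maximum of the eigenvector, and the extremal tree. -/

section Trees

/-- Attaching to the root every non-root vertex outside the lower ends `W` of a matching yields the
star with pendant edges. -/
theorem exists_isRootedBy_nonempty_iso_starWithPendants {V : Type*} [Fintype V] [DecidableEq V]
    {u : V} {p : V → V} {W : Finset V} {i m : ℕ} (hm : m ≤ i) (hn : Fintype.card V = i + m + 1)
    (hWm : W.card = m) (huW : u ∉ W) (hpu : ∀ w ∈ W, p w ≠ u) (hpW : ∀ w ∈ W, p w ∉ W)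
    (hinj : Set.InjOn p W) :
    ∃ (G : SimpleGraph V) (d : V → ℕ), IsRootedBy G u (fun v => if v ∈ W then p v else u) d ∧
      Nonempty (G ≃g starWithPendants i m) := by
  let d : V → ℕ := fun v => if v = u then 0 else if v ∈ W then 2 else 1
  have hd : ∀ v, v ≠ u → d (if v ∈ W then p v else u) < d v := by
    intro v hv
    by_cases hvW : v ∈ W
    · simp [d, hv, hvW, hpu v hvW, hpW v hvW]
    · simp [d, hv, hvW]
  have hG := isRootedBy_fromRel hd
  refine ⟨_, d, hG, ?_⟩
  let wE : W ≃ Fin m := W.equivFinOfCardEq hWm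
  have hLcard : Fintype.card (Fin i) = ((Finset.univ.erase u) \ W).card := by
    rw [Finset.card_sdiff_of_subset, Finset.card_erase_of_mem (Finset.mem_univ _), Finset.card_univ,
      Fintype.card_fin]
    · omega
    · intro w hw
      exact Finset.mem_erase.2 ⟨fun h => huW (h ▸ hw), Finset.mem_univ _⟩
  -- The first `m` leaves must be the parents of the vertices of `W`, in matching order. The value
  -- `u` is a dummy: only indices below `m` are used when `f` is extended to a bijection.
  let f : Fin i → V := fun a => if h : (a : ℕ) < m then p (wE.symm ⟨a, h⟩) else u
  obtain ⟨g, hg⟩ := Finset.exists_equiv_extend_of_card_eq hLcard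
    (s := Finset.univ.filter fun a : Fin i => (a : ℕ) < m) (f := f) (by
      intro v hv
      obtain ⟨a, ha, rfl⟩ := Finset.mem_image.1 hv
      have ha : (a : ℕ) < m := by simpa using ha
      simp only [f, dif_pos ha]
      have := (wE.symm ⟨a, ha⟩).2
      simp [hpu _ this, hpW _ this]) (by
      intro a ha b hb hab
      have ha : (a : ℕ) < m := by simpa using ha
      have hb : (b : ℕ) < m := by simpa using hb
      simp only [f, dif_pos ha, dif_pos hb] at hab
      have h1 := hinj (wE.symm ⟨a, ha⟩).2 (wE.symm ⟨b, hb⟩).2 hab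
      have h2 := wE.symm.injective (Subtype.ext h1)
      exact Fin.ext (by simpa using h2))
  have hgL : ∀ a, (g a : V) ≠ u ∧ (g a : V) ∉ W := fun a => by
    have h := Finset.mem_sdiff.1 (g a).2
    exact ⟨Finset.ne_of_mem_erase h.1, h.2⟩
  let F : Unit ⊕ (Fin i ⊕ Fin m) → V :=
    Sum.elim (fun _ => u) (Sum.elim (fun a => (g a : V)) (fun b => (wE.symm b : V)))
  have hwu : ∀ b, (wE.symm b : V) ≠ u := fun b h => huW (h ▸ (wE.symm b).2)
  have hF : Function.Injective F := by
    rintro (v | v | v) (w | w | w) h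
    · rfl
    · exact absurd h.symm (hgL w).1
    · exact absurd h.symm (hwu w)
    · exact absurd h (hgL v).1
    · rw [g.injective (Subtype.ext h)]
    · exact absurd ((show (g v : V) = wE.symm w from h) ▸ (wE.symm w).2) (hgL v).2
    · exact absurd h (hwu v)
    · exact absurd ((show (wE.symm v : V) = g w from h) ▸ (wE.symm v).2) (hgL w).2
    · rw [wE.symm.injective (Subtype.ext h)]
  have hFb : Function.Bijective F := (Fintype.bijective_iff_injective_and_card F).2 ⟨hF, by
    simp only [Fintype.card_sum, Fintype.card_unit, Fintype.card_fin]; omega⟩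
  obtain ⟨e⟩ := (isRootedBy_starWithPendants hm).nonempty_iso hG (Equiv.ofBijective F hFb) rfl (by
    rintro (v | v | v) hv
    · exact absurd rfl hv
    · simp [starParent, F, (hgL v).2]
    · have h1 : (g (Fin.castLE hm v) : V) = p (wE.symm v) := by
        rw [hg _ (by simp)]
        simp [f]
      simp [starParent, F, h1])
  exact ⟨e.symm⟩

/-- Reattaching vertices at a root where a positive top eigenvector is maximal does not decrease the
`A_α`-index, and strictly increases it unless the graph is unchanged. -/
theorem IsRootedBy.aAlphaIndex_le {V : Type*} [Fintype V] [DecidableEq V] {G H : SimpleGraph V}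
    {u : V} {p : V → V} {W : Finset V} {d d' : V → ℕ} {α : ℝ} (hα0 : 0 ≤ α) (hα : α < 1)
    (hG : IsRootedBy G u p d) (hH : IsRootedBy H u (fun v => if v ∈ W then p v else u) d')
    (hpu : ∀ w ∈ W, p w ≠ u) {x : V → ℝ} (hx : ∀ v, 0 < x v) (hxu : ∀ v, x v ≤ x u)
    (hxe : aAlphaMatrix G α *ᵥ x = aAlphaIndex G α • x) :
    aAlphaIndex G α ≤ aAlphaIndex H α ∧ (aAlphaIndex G α = aAlphaIndex H α → G = H) := by
  classical
  have : Nonempty V := ⟨u⟩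
  have hxx : 0 < x ⬝ᵥ x := Finset.sum_pos (fun v _ => mul_pos (hx v) (hx v)) Finset.univ_nonempty
  have hquad : aAlphaIndex G α * (x ⬝ᵥ x) ≤ x ⬝ᵥ aAlphaMatrix H α *ᵥ x := by
    have h1 : aAlphaIndex G α * (x ⬝ᵥ x) = x ⬝ᵥ aAlphaMatrix G α *ᵥ x := by
      rw [hxe, dotProduct_smul, smul_eq_mul]
    rw [h1, hG.dotProduct_aAlphaMatrix_mulVec, hH.dotProduct_aAlphaMatrix_mulVec]
    refine Finset.sum_le_sum fun v _ => ?_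
    by_cases hvW : v ∈ W
    · simp [hvW]
    · simp only [hvW, if_false]
      split_ifs
      · have h2 := mul_self_le_mul_self (hx (p v)).le (hxu (p v))
        have h3 := mul_le_mul_of_nonneg_left (hxu (p v)) (hx v).le
        have h4 := mul_le_mul_of_nonneg_left h2 hα0
        have h5 := mul_le_mul_of_nonneg_left h3 (sub_nonneg.2 hα.le)
        linarith
      · exact le_rfl
  refine ⟨le_of_mul_le_mul_right (hquad.trans (dotProduct_mulVec_le_aAlphaIndex H α x)) hxx,
    fun heq => ?_⟩
  have hxH : aAlphaMatrix H α *ᵥ x = aAlphaIndex H α • x :=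
    mulVec_eq_of_aAlphaIndex_le (heq ▸ hquad)
  -- `x` is now a top eigenvector of both graphs, so their rows at `u` agree. As `H` only gains
  -- neighbours of `u`, each contributing a positive term, there are none to gain: every vertex
  -- outside `W` already had parent `u`.
  have hsub : ∀ w, G.Adj u w → H.Adj u w := fun w hw => by
    rcases (hG.adj_iff u w).1 hw with ⟨h1, _⟩ | ⟨h1, h2⟩
    · exact absurd rfl h1
    · refine (hH.adj_iff u w).2 (Or.inr ⟨h1, ?_⟩)
      rw [if_neg fun hwW => hpu w hwW h2]
  have hrow : ∑ w, (if G.Adj u w then α * x u + (1 - α) * x w else 0) =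
      ∑ w, if H.Adj u w then α * x u + (1 - α) * x w else 0 := by
    rw [← aAlphaMatrix_mulVec_apply, ← aAlphaMatrix_mulVec_apply, hxe, hxH, heq]
  have hpos : ∀ w, 0 < α * x u + (1 - α) * x w := fun w =>
    add_pos_of_nonneg_of_pos (mul_nonneg hα0 (hx u).le) (mul_pos (sub_pos.2 hα) (hx w))
  have hterm := (Finset.sum_eq_sum_iff_of_le fun w _ => by
    by_cases hw : G.Adj u w
    · rw [if_pos hw, if_pos (hsub w hw)]
    · rw [if_neg hw]
      split_ifs
      · exact (hpos w).le
      · exact le_rfl).1 hrow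
  have hiff : ∀ w, H.Adj u w → G.Adj u w := fun w hw => by
    by_contra hno
    have := hterm w (Finset.mem_univ _)
    rw [if_neg hno, if_pos hw] at this
    exact (hpos w).ne this
  have hp : ∀ v, v ≠ u → (if v ∈ W then p v else u) = p v := fun v hv => by
    split_ifs with hvW
    · rfl
    · have h1 : H.Adj u v := (hH.adj_iff u v).2 (Or.inr ⟨hv, if_neg hvW⟩)
      rcases (hG.adj_iff u v).1 (hiff v h1) with ⟨h2, _⟩ | ⟨_, h2⟩
      · exact absurd rfl h2
      · exact h2.symm
  ext v w
  rw [hG.adj_iff, hH.adj_iff]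
  exact or_congr (and_congr_right fun h => by rw [hp v h])
    (and_congr_right fun h => by rw [hp w h])

theorem aAlphaIndex_le_starWithPendants {V : Type*} [Fintype V] {T : SimpleGraph V} (hT : T.IsTree)
    {i m : ℕ} (hm : m ≤ i) (hn : Fintype.card V = i + m + 1) (hind : T.indepNum = i) {α : ℝ}
    (hα0 : 0 ≤ α) (hα : α < 1) :
    aAlphaIndex T α ≤ aAlphaIndex (starWithPendants i m) α ∧
      (aAlphaIndex T α = aAlphaIndex (starWithPendants i m) α →
        Nonempty (T ≃g starWithPendants i m)) := by
  classical
  have := hT.connected.nonempty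
  obtain ⟨x, hx, hxe⟩ := exists_pos_eigenvector hT.connected hα
  obtain ⟨u, hxu⟩ := Finite.exists_max x
  obtain ⟨p, d, hroot⟩ := hT.exists_isRootedBy u
  obtain ⟨I, W', -, hW', hI, hWp, hinj, hcard⟩ :=
    hroot.exists_matching (Finset.univ.erase u) (by simp)
  rw [Finset.card_erase_of_mem (Finset.mem_univ _), Finset.card_univ] at hcard
  have hIi := hI.card_le_indepNum
  -- From `i + m = n - 1 ≤ |I| + |W'|` and `|I| ≤ i`.
  obtain ⟨W, hWW, hWm⟩ := Finset.exists_subset_card_eq (show m ≤ W'.card by omega)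
  have hpu : ∀ w ∈ W, p w ≠ u := fun w hw => Finset.ne_of_mem_erase (hWp w (hWW hw)).1
  obtain ⟨H, d', hH, ⟨e⟩⟩ := exists_isRootedBy_nonempty_iso_starWithPendants hm hn hWm
    (fun h => by simpa using hW' (hWW h)) hpu (fun w hw h => (hWp w (hWW hw)).2 (hWW h))
    (hinj.mono hWW)
  obtain ⟨h1, h2⟩ := hroot.aAlphaIndex_le hα0 hα hH hpu hx hxu hxe
  rw [aAlphaIndex_congr e] at h1 h2
  exact ⟨h1, fun h => h2 h ▸ ⟨e⟩⟩

end Trees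

theorem theorem1p5 (n i : ℕ) (hi : ⌈(n : ℚ) / 2⌉₊ ≤ i) (hin : i + 1 ≤ n) :
    -- bipartite graphs
    ((completeBipartiteGraph (Fin i) (Fin (n - i))).IsBipartite ∧
      (completeBipartiteGraph (Fin i) (Fin (n - i))).Connected ∧
      Fintype.card (Fin i ⊕ Fin (n - i)) = n ∧
      (completeBipartiteGraph (Fin i) (Fin (n - i))).indepNum = i ∧
      ∀ α ∈ Set.Ico (1 / 2 : ℝ) 1, ∀ {V : Type*} [Fintype V] (G : SimpleGraph V),
        Fintype.card V = n → G.IsBipartite → G.indepNum = i →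
          aAlphaIndex G α ≤ aAlphaIndex (completeBipartiteGraph (Fin i) (Fin (n - i))) α ∧
          (aAlphaIndex G α = aAlphaIndex (completeBipartiteGraph (Fin i) (Fin (n - i))) α ↔
            Nonempty (G ≃g completeBipartiteGraph (Fin i) (Fin (n - i))))) ∧
    -- trees
    (4 ≤ n →
      (sStar n i).IsTree ∧
      Fintype.card (Unit ⊕ (Fin i ⊕ Fin (n - i - 1))) = n ∧
      (sStar n i).indepNum = i ∧
      ∀ α ∈ Set.Ico (0 : ℝ) 1, ∀ {V : Type*} [Fintype V] (T : SimpleGraph V),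
        Fintype.card V = n → T.IsTree → T.indepNum = i →
          aAlphaIndex T α ≤ aAlphaIndex (sStar n i) α ∧
          (aAlphaIndex T α = aAlphaIndex (sStar n i) α ↔ Nonempty (T ≃g sStar n i))) := by
  have hn2 : n ≤ 2 * i := by
    have h : (n : ℚ) / 2 ≤ i := Nat.ceil_le.1 hi
    have h : (n : ℚ) ≤ 2 * i := by linarith
    exact_mod_cast h
  -- These instances make both parts nonempty, as connectedness requires.
  have : NeZero i := ⟨by omega⟩
  have : NeZero (n - i) := ⟨by omega⟩
  refine ⟨⟨completeBipartiteGraph_isBipartite _ _, completeBipartiteGraph_connected _ _, ?_,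
    indepNum_completeBipartiteGraph (by omega), ?_⟩, fun _ => ⟨?_, ?_,
    indepNum_starWithPendants (by omega), ?_⟩⟩
  · simp only [Fintype.card_sum, Fintype.card_fin]; omega
  · intro α hα V _ G hn hG hind
    obtain ⟨h1, h2⟩ := aAlphaIndex_le_bipartiteRoot hα.1 hα.2 hn2 (by omega) hn hG hind
    -- Only `ρ ≤ λ_α(K_{i,n-i})` is needed: equality of the indices then squeezes `λ_α(G)` to `ρ`.
    have h3 := bipartiteRoot_le_aAlphaIndex hα.2 (show 0 < i by omega) (show 0 < n - i by omega)
    exact ⟨h1.trans h3, fun h => h2 (le_antisymm h1 (h ▸ h3)), fun ⟨e⟩ => aAlphaIndex_congr e α⟩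
  · exact (isRootedBy_starWithPendants (by omega)).isTree
  · simp only [Fintype.card_sum, Fintype.card_fin, Fintype.card_unit]; omega
  · intro α hα V _ T hn hT hind
    obtain ⟨h1, h2⟩ := aAlphaIndex_le_starWithPendants hT (show n - i - 1 ≤ i by omega) (by omega)
      hind hα.1 hα.2
    exact ⟨h1, h2, fun ⟨e⟩ => aAlphaIndex_congr e α⟩
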